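/- Let $(G,O)$ be an equipped finite group whose equipment generates $G$: that is, $G$ is a finite group and $O\subset G\setminus\{1\}$ is a non-empty subset, invariant under conjugation, which generates $G$. Let $S(G,O)$ be the semigroup generated by letters $x_g$, $g\in O$, subject to the relations $x_{g_1}x_{g_2}=x_{g_2}x_{g_2^{-1}g_1g_2}=x_{g_1g_2g_1^{-1}}x_{g_1}$ for $g_1,g_2\in O$, and let $\alpha_G:S(G,O)\to G$, $x_g\mapsto g$, be the product homomorphism. Let $G_\Gamma$ be the group generated by $y_g$, $g\in O$, subject to the relations $y_{g}^{-1}y_{g_1}y_{g}=y_{g_2}$ for all $g,g_1,g_2\in O$ with $g^{-1}g_1g=g_2$ in $G$ (the $C$-group of the $C$-graph $\Gamma$ of $(G,O)$), let $\beta:G_\Gamma\to G$, $y_g\mapsto g$, be the natural epimorphism, and let $a_{(G,O)}=|\ker\beta\cap[G_\Gamma,G_\Gamma]|$ be the ambiguity index of $(G,O)$. Let $\tau:S(G,O)\to G_\Gamma/[G_\Gamma,G_\Gamma]$, $x_g\mapsto y_g\bmod [G_\Gamma,G_\Gamma]$, be the type homomorphism; equivalently, $\tau(s)$ records the number of factors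 of $s$ in each conjugacy class contained in $O$. For $s=x_{g_1}\cdots x_{g_n}\in S(G,O)$ let $G_s=\langle g_1,\dots,g_n\rangle$, and put $S(G,O)^G=\{s\mid G_s=G\}$, $S(G,O)_{\mathbf 1}=\{s\mid \alpha_G(s)=1\}$ and $S(G,O)^G_{\mathbf 1}=S(G,O)^G\cap S(G,O)_{\mathbf 1}$. A subsemigroup $T\subset S(G,O)$ is called stable if there is an element $s\in T$ such that $s_1 s=s_2 s$ for any two elements $s_1,s_2\in T$ with $\alpha_G(s_1)=\alpha_G(s_2)$ and $\tau(s_1)=\tau(s_2)$. Then the semigroup $S(G,O)$ is stable if and only if $a_{(G,O)}=1$. Likewise, each of the semigroups $S(G,O)^G$, $S(G,O)_{\mathbf 1}$ and $S(G,O)^G_{\mathbf 1}$ is stable if and only if $a_{(G,O)}=1$. -/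

import Mathlib

/-- An equipment of a group `G`: a subset `O` of `G` that is invariant under inner automorphisms
and does not contain the unit.  The pair `(G, O)` is an equipped group. -/
structure Equipment (G : Type*) [Group G] where
  carrier : Set G
  conj_mem : ∀ h g : G, g ∈ carrier → h * g * h⁻¹ ∈ carrier
  one_notMem : (1 : G) ∉ carrier

namespace Equipment

variable {G : Type*} [Group G] (O : Equipment G)

/-- The elements of `O` as a type. -/
abbrev Elem : Type _ := {g : G // g ∈ O.carrier}

/-- `conj h g = h g h⁻¹`, as an element of `O`. -/
def conj (h : G) (g : O.Elem) : O.Elem := ⟨h * g.1 * h⁻¹, O.conj_mem h g.1 g.2⟩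

/-- `conjInv h g = h⁻¹ g h`, as an element of `O`. -/
def conjInv (h : G) (g : O.Elem) : O.Elem :=
  ⟨h⁻¹ * g.1 * h, by simpa using O.conj_mem h⁻¹ g.1 g.2⟩

/-! ### The factorization semigroup -/

/-- The defining relations
`x_{g₁} x_{g₂} = x_{g₂} x_{g₂⁻¹ g₁ g₂}` and `x_{g₁} x_{g₂} = x_{g₁ g₂ g₁⁻¹} x_{g₁}`. -/
inductive Rel : FreeSemigroup O.Elem → FreeSemigroup O.Elem → Prop
  | right (g₁ g₂ : O.Elem) :
      Rel (FreeSemigroup.of g₁ * FreeSemigroup.of g₂)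
        (FreeSemigroup.of g₂ * FreeSemigroup.of (O.conjInv g₂.1 g₁))
  | left (g₁ g₂ : O.Elem) :
      Rel (FreeSemigroup.of g₁ * FreeSemigroup.of g₂)
        (FreeSemigroup.of (O.conj g₁.1 g₂) * FreeSemigroup.of g₁)

/-- The factorization semigroup `S(G, O)`: the semigroup generated by the letters `x_g`, `g ∈ O`,
subject to the relations `Rel`. -/
abbrev FactSemigroup : Type _ := (conGen O.Rel).Quotient

/-- The generator `x_g` of `S(G, O)`. -/
def gen (g : O.Elem) : O.FactSemigroup := (FreeSemigroup.of g : FreeSemigroup O.Elem)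

/-- The homomorphism from `S(G, O)` to a semigroup `M` with `x_g ↦ f g`, for a map `f : O → M`
that respects the defining relations. -/
def lift {M : Type*} [Semigroup M] (f : O.Elem → M)
    (hf : ∀ a b, O.Rel a b → FreeSemigroup.lift f a = FreeSemigroup.lift f b) :
    O.FactSemigroup →ₙ* M where
  toFun s := Con.liftOn s (FreeSemigroup.lift f) fun _ _ h =>
    (Con.conGen_le (c := Con.ker (FreeSemigroup.lift f))).2 hf h
  map_mul' := by
    rintro ⟨a⟩ ⟨b⟩
    exact map_mul (FreeSemigroup.lift f) a b

/-- The product homomorphism `α_G : S(G, O) → G`, `x_g ↦ g`. -/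
def prodHom : O.FactSemigroup →ₙ* G :=
  O.lift (fun g => g.1) (by
    intro a b h
    cases h <;> simp [conj, conjInv, mul_assoc])

/-- The subgroup of `G` generated by the letters of a word. -/
def wordSubgroup (w : FreeSemigroup O.Elem) : Subgroup G :=
  Subgroup.closure {g : G | ∃ a : O.Elem, (a = w.head ∨ a ∈ w.tail) ∧ a.1 = g}

theorem wordSubgroup_mul (v w : FreeSemigroup O.Elem) :
    O.wordSubgroup (v * w) = O.wordSubgroup v ⊔ O.wordSubgroup w := by
  rw [wordSubgroup, wordSubgroup, wordSubgroup, ← Subgroup.closure_union]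
  congr 1
  ext g
  simp only [FreeSemigroup.head_mul, FreeSemigroup.tail_mul, List.mem_append, List.mem_cons,
    Set.mem_ofPred_eq, Set.mem_union]
  grind

theorem wordSubgroup_of (a : O.Elem) :
    O.wordSubgroup (FreeSemigroup.of a) = Subgroup.closure {a.1} := by
  rw [wordSubgroup]
  congr 1
  ext g
  simp [FreeSemigroup.of, eq_comm]

/-- The subgroup generated by the letters does not depend on the word representing a given
element of `S(G, O)`. -/
theorem wordSubgroup_eq {v w : FreeSemigroup O.Elem} (h : conGen O.Rel v w) :
    O.wordSubgroup v = O.wordSubgroup w := by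
  let c : Con (FreeSemigroup O.Elem) :=
    { r := fun a b => O.wordSubgroup a = O.wordSubgroup b
      iseqv := ⟨fun _ => rfl, fun h => h.symm, fun h₁ h₂ => h₁.trans h₂⟩
      mul' := fun h₁ h₂ => by simp only [wordSubgroup_mul] at *; rw [h₁, h₂] }
  refine (Con.conGen_le (c := c)).2 ?_ h
  intro a b hab
  change O.wordSubgroup a = O.wordSubgroup b
  cases hab with
  | right g₁ g₂ =>
    simp only [wordSubgroup_mul, wordSubgroup_of, conjInv, ← Subgroup.closure_union]
    apply le_antisymm <;> rw [Subgroup.closure_le] <;> rintro x (rfl | rfl)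
    · have h₂ : g₂.1 ∈ Subgroup.closure ({g₂.1} ∪ {g₂.1⁻¹ * g₁.1 * g₂.1} : Set G) :=
        Subgroup.subset_closure (by simp)
      have h₃ : g₂.1⁻¹ * g₁.1 * g₂.1 ∈
          Subgroup.closure ({g₂.1} ∪ {g₂.1⁻¹ * g₁.1 * g₂.1} : Set G) :=
        Subgroup.subset_closure (by simp)
      simpa [mul_assoc] using mul_mem (mul_mem h₂ h₃) (inv_mem h₂)
    · exact Subgroup.subset_closure (by simp)
    · exact Subgroup.subset_closure (by simp)
    · have h₁ : g₁.1 ∈ Subgroup.closure ({g₁.1} ∪ {g₂.1} : Set G) :=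
        Subgroup.subset_closure (by simp)
      have h₂ : g₂.1 ∈ Subgroup.closure ({g₁.1} ∪ {g₂.1} : Set G) :=
        Subgroup.subset_closure (by simp)
      exact mul_mem (mul_mem (inv_mem h₂) h₁) h₂
  | left g₁ g₂ =>
    simp only [wordSubgroup_mul, wordSubgroup_of, conj, ← Subgroup.closure_union]
    apply le_antisymm <;> rw [Subgroup.closure_le] <;> rintro x (rfl | rfl)
    · exact Subgroup.subset_closure (by simp)
    · have h₁ : g₁.1 ∈ Subgroup.closure ({g₁.1 * g₂.1 * g₁.1⁻¹} ∪ {g₁.1} : Set G) :=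
        Subgroup.subset_closure (by simp)
      have h₃ : g₁.1 * g₂.1 * g₁.1⁻¹ ∈
          Subgroup.closure ({g₁.1 * g₂.1 * g₁.1⁻¹} ∪ {g₁.1} : Set G) :=
        Subgroup.subset_closure (by simp)
      simpa [mul_assoc] using mul_mem (mul_mem (inv_mem h₁) h₃) h₁
    · have h₁ : g₁.1 ∈ Subgroup.closure ({g₁.1} ∪ {g₂.1} : Set G) :=
        Subgroup.subset_closure (by simp)
      have h₂ : g₂.1 ∈ Subgroup.closure ({g₁.1} ∪ {g₂.1} : Set G) :=
        Subgroup.subset_closure (by simp)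
      exact mul_mem (mul_mem h₁ h₂) (inv_mem h₁)
    · exact Subgroup.subset_closure (by simp)

/-- The subgroup `G_s` of `G` generated by the factors `g₁, …, gₙ` of
`s = x_{g₁} ⋯ x_{gₙ} ∈ S(G, O)`. -/
def factorSubgroup (s : O.FactSemigroup) : Subgroup G :=
  Con.liftOn s O.wordSubgroup fun _ _ h => O.wordSubgroup_eq h

theorem factorSubgroup_mul (s t : O.FactSemigroup) :
    O.factorSubgroup (s * t) = O.factorSubgroup s ⊔ O.factorSubgroup t := by
  obtain ⟨v⟩ := s
  obtain ⟨w⟩ := t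
  exact O.wordSubgroup_mul v w

/-- The subsemigroup `S(G, O)^H = {s | G_s = H}`. -/
def withFactorSubgroup (H : Subgroup G) : Subsemigroup O.FactSemigroup where
  carrier := {s | O.factorSubgroup s = H}
  mul_mem' {s t} hs ht := by
    simp only [Set.mem_ofPred_eq] at *
    rw [factorSubgroup_mul, hs, ht, sup_idem]

/-- The subsemigroup `S(G, O)_Z = {s | α_G(s) ∈ Z}`. -/
def withProductIn (Z : Subgroup G) : Subsemigroup O.FactSemigroup where
  carrier := {s | O.prodHom s ∈ Z}
  mul_mem' {s t} hs ht := by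
    simp only [Set.mem_ofPred_eq, map_mul] at *
    exact mul_mem hs ht

/-! ### The `C`-group of an equipped group, the ambiguity index and the type -/

/-- The edges of the `C`-graph `Γ` of `(G, O)`, whose vertices are the elements of `O`:
there is an edge from `v₁` to `v₂` with label `v₃` if and only if `v₃⁻¹ v₁ v₃ = v₂` in `G`. -/
def GraphEdge (v₁ v₂ v₃ : O.Elem) : Prop := v₃.1⁻¹ * v₁.1 * v₃.1 = v₂.1

/-- The relators `y_{v₃}⁻¹ y_{v₁} y_{v₃} y_{v₂}⁻¹`, one for each edge from `v₁` to `v₂` with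
label `v₃`. -/
def graphRels : Set (FreeGroup O.Elem) :=
  {r | ∃ v₁ v₂ v₃ : O.Elem, O.GraphEdge v₁ v₂ v₃ ∧
    r = (FreeGroup.of v₃)⁻¹ * FreeGroup.of v₁ * FreeGroup.of v₃ * (FreeGroup.of v₂)⁻¹}

/-- The `C`-group `G_Γ` associated with the `C`-graph `Γ` of `(G, O)`. -/
abbrev CGroup : Type _ := PresentedGroup O.graphRels

/-- The `C`-generator `y_g` of `G_Γ`. -/
def cgen (g : O.Elem) : O.CGroup := PresentedGroup.of g

theorem cgen_rel {v₁ v₂ v₃ : O.Elem} (h : O.GraphEdge v₁ v₂ v₃) :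
    O.cgen v₁ * O.cgen v₃ = O.cgen v₃ * O.cgen v₂ := by
  have h₁ : (PresentedGroup.mk O.graphRels) ((FreeGroup.of v₃)⁻¹ * FreeGroup.of v₁ *
      FreeGroup.of v₃ * (FreeGroup.of v₂)⁻¹) = 1 :=
    PresentedGroup.one_of_mem ⟨v₁, v₂, v₃, h, rfl⟩
  simp only [map_mul, map_inv] at h₁
  have h₂ : (O.cgen v₃)⁻¹ * O.cgen v₁ * O.cgen v₃ * (O.cgen v₂)⁻¹ = 1 := h₁
  rw [mul_inv_eq_one] at h₂
  rw [← h₂]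
  group

/-- The natural homomorphism `β : G_Γ → G`, `y_g ↦ g`. -/
def beta : O.CGroup →* G :=
  PresentedGroup.toGroup (f := fun g : O.Elem => g.1) (by
    rintro r ⟨v₁, v₂, v₃, h, rfl⟩
    simpa [mul_inv_eq_one, GraphEdge] using h)

/-- The ambiguity index `a_{(G, O)} = |ker β ∩ [G_Γ, G_Γ]|`. -/
noncomputable def ambiguityIndex : ℕ :=
  Nat.card (O.beta.ker ⊓ commutator O.CGroup : Subgroup O.CGroup)

/-- The product homomorphism `α_{G_Γ} : S(G, O) → G_Γ`, `x_g ↦ y_g`. -/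
def cprodHom : O.FactSemigroup →ₙ* O.CGroup :=
  O.lift O.cgen (by
    intro a b h
    cases h with
    | right g₁ g₂ => simpa using O.cgen_rel (v₁ := g₁) (v₂ := O.conjInv g₂.1 g₁) (v₃ := g₂) rfl
    | left g₁ g₂ =>
      simpa using (O.cgen_rel (v₁ := O.conj g₁.1 g₂) (v₂ := g₂) (v₃ := g₁)
        (by simp [GraphEdge, conj, mul_assoc])).symm)

/-- The type homomorphism `τ = ab ∘ α_{G_Γ} : S(G, O) → G_Γ / [G_Γ, G_Γ]`.  The target is free
abelian on the connected components of `Γ` (the conjugacy classes contained in `O`, when `O`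
generates `G`), and `τ(s)` counts the factors of `s` in each of them. -/
def typeHom : O.FactSemigroup →ₙ* Abelianization O.CGroup :=
  (Abelianization.of : O.CGroup →* Abelianization O.CGroup).toMulHom.comp O.cprodHom

/-- A subsemigroup `T` of `S(G, O)` is stable over `G` if it has an element `s` such that
`s₁ s = s₂ s` for any two elements `s₁`, `s₂` of `T` with the same product in `G` and the same
type. -/
def IsStable (T : Subsemigroup O.FactSemigroup) : Prop :=
  ∃ s ∈ T, ∀ s₁ ∈ T, ∀ s₂ ∈ T,
    O.prodHom s₁ = O.prodHom s₂ → O.typeHom s₁ = O.typeHom s₂ → s₁ * s = s₂ * s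

end Equipment

/-! Adjoin a unit to `S(G, O)`. Each `x_g ^ |G|` is central, and the product `z` of these powers
over `g ∈ O` is central, has product `1` in `G` and is divisible by every letter. Inverting `z`
makes every letter a unit, so the localization map factors through `G_Γ`: elements with equal image
in `G_Γ` agree after multiplication by some power of `z`. A Noetherian argument makes this power
uniform.

If the index is one, product and type determine the image in `G_Γ`, so a large power of `z`
witnesses stability. Conversely, each `γ ∈ ker β ∩ [G_Γ, G_Γ]` is a quotient of the images of two
elements with the same product and type; stability and cancellation in `G_Γ` force `γ = 1`. -/

/-! ### Uniform exponents from Noetherianity -/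

/-- If a monoid is covered by finitely many translates of the submonoid generated by finitely many
central elements, then the kernels of the powers of left multiplication by a fixed element
stabilize. -/
theorem exists_uniform_pow_mul_eq {M ι : Type*} [Monoid M] [Finite ι] (p : ι → M)
    (hp : ∀ i m, Commute (p i) m) (F : Set M) (hF : F.Finite)
    (hcover : ∀ m : M, ∃ e ∈ Submonoid.closure (Set.range p), ∃ f ∈ F, m = e * f) (z : M) :
    ∃ K : ℕ, ∀ (k : ℕ) (a b : M), z ^ k * a = z ^ k * b → z ^ K * a = z ^ K * b := by
  -- In the monoid ring, `z ^ k * a = z ^ k * b` says that `z ^ k` annihilates `a - b`.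
  let R := MonoidAlgebra ℤ M
  let δ : M →* R := MonoidAlgebra.of ℤ M
  have hδ : Function.Injective δ := MonoidAlgebra.of_injective
  have hδspan (x : R) : x ∈ AddSubgroup.closure (Set.range δ) := by
    induction x using MonoidAlgebra.induction_linear with
    | zero => exact zero_mem _
    | add x y hx hy => exact add_mem hx hy
    | single m r =>
      have : MonoidAlgebra.single m r = r • δ m := by
        rw [MonoidAlgebra.of_apply, MonoidAlgebra.smul_single, smul_eq_mul, mul_one]
      rw [this]
      exact zsmul_mem (AddSubgroup.subset_closure (Set.mem_range_self m)) r
  have hcentral (i : ι) : δ (p i) ∈ Subalgebra.center ℤ R := by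
    rw [Subalgebra.mem_center_iff]
    intro x
    induction hδspan x using AddSubgroup.closure_induction with
    | mem x hx =>
      obtain ⟨m, rfl⟩ := hx
      rw [← map_mul, ← map_mul, (hp i m).eq]
    | zero => simp
    | add x y _ _ hx hy => rw [add_mul, mul_add, hx, hy]
    | neg x _ hx => rw [neg_mul, mul_neg, hx]
  -- The variable `X i` acts as the central element `p i`; the cover makes `F` a finite generating
  -- set of `R` as a module.
  let φ : MvPolynomial ι ℤ →ₐ[ℤ] Subalgebra.center ℤ R :=
    MvPolynomial.aeval fun i => ⟨δ (p i), hcentral i⟩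
  let : Module (MvPolynomial ι ℤ) R := Module.compHom R φ.toRingHom
  have hsmul (q : MvPolynomial ι ℤ) (x : R) : q • x = (φ q : R) * x := rfl
  have hclosure : ∀ e ∈ Submonoid.closure (Set.range p), ∃ q, (φ q : R) = δ e := by
    intro e he
    induction he using Submonoid.closure_induction with
    | mem x hx =>
      obtain ⟨i, rfl⟩ := hx
      exact ⟨MvPolynomial.X i, by simp [φ]⟩
    | one => exact ⟨1, by simp⟩
    | mul x y _ _ hx hy =>
      obtain ⟨q, hq⟩ := hx
      obtain ⟨r, hr⟩ := hy
      exact ⟨q * r, by simp [hq, hr]⟩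
  have : Module.Finite (MvPolynomial ι ℤ) R := by
    refine ⟨Submodule.fg_def.2 ⟨δ '' F, hF.image _, ?_⟩⟩
    rw [eq_top_iff]
    rintro x -
    induction hδspan x using AddSubgroup.closure_induction with
    | mem x hx =>
      obtain ⟨m, rfl⟩ := hx
      obtain ⟨e, he, f, hf, rfl⟩ := hcover m
      obtain ⟨q, hq⟩ := hclosure e he
      rw [map_mul, ← hq, ← hsmul]
      exact Submodule.smul_mem _ _ (Submodule.subset_span ⟨f, hf, rfl⟩)
    | zero => exact zero_mem _
    | add x y _ _ hx hy => exact add_mem hx hy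
    | neg x _ hx => exact neg_mem hx
  have : IsNoetherian (MvPolynomial ι ℤ) R := isNoetherian_of_isNoetherianRing_of_finite _ _
  -- The annihilators of the `z ^ k` form an ascending chain of submodules, hence a stationary one.
  let ker (k : ℕ) : Submodule (MvPolynomial ι ℤ) R :=
    { carrier := {x | δ z ^ k * x = 0}
      zero_mem' := by simp
      add_mem' := by
        intro x y hx hy
        simp only [Set.mem_ofPred_eq] at *
        rw [mul_add, hx, hy, add_zero]
      smul_mem' := by
        intro q x hx
        simp only [Set.mem_ofPred_eq] at *
        rw [hsmul, ← mul_assoc, Subalgebra.mem_center_iff.1 (φ q).2, mul_assoc, hx, mul_zero] }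
  have hker (k : ℕ) (a b : M) : δ a - δ b ∈ ker k ↔ z ^ k * a = z ^ k * b := by
    change δ z ^ k * (δ a - δ b) = 0 ↔ _
    rw [mul_sub, sub_eq_zero, ← map_pow, ← map_mul, ← map_mul, hδ.eq_iff]
  have hmono : Monotone ker := by
    refine monotone_nat_of_le_succ fun k x hx => ?_
    change δ z ^ (k + 1) * x = 0
    change δ z ^ k * x = 0 at hx
    rw [pow_succ', mul_assoc, hx, mul_zero]
  obtain ⟨K, hK⟩ := monotone_stabilizes_iff_noetherian.2 this ⟨ker, hmono⟩
  refine ⟨K, fun k a b hab => ?_⟩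
  rw [← hker] at hab ⊢
  rcases le_total K k with h | h
  · have : ker K = ker k := hK k h
    rwa [this]
  · exact hmono h hab

/-! ### Localization at a central element -/

/-- A submonoid of the center is an Ore set. -/
abbrev OreLocalization.oreSetOfCentral {M : Type*} [Monoid M] (S : Submonoid M)
    (hS : ∀ s ∈ S, ∀ m, Commute s m) : OreLocalization.OreSet S where
  ore_right_cancel a b s h := ⟨s, by rwa [(hS s s.2 a).eq, (hS s s.2 b).eq]⟩
  oreNum r _ := r
  oreDenom _ s := s
  ore_eq r s := (hS s s.2 r).eq

/-- Elements that become equal in the localization at the powers of a central element become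
equal after multiplication by such a power. -/
theorem exists_pow_mul_eq_of_numeratorHom_eq {M : Type*} [Monoid M] (z : M)
    [OreLocalization.OreSet (Submonoid.powers z)] {a b : M}
    (h : (OreLocalization.numeratorHom a : OreLocalization (Submonoid.powers z) M) =
      OreLocalization.numeratorHom b) : ∃ k : ℕ, z ^ k * a = z ^ k * b := by
  rw [OreLocalization.numeratorHom_apply, OreLocalization.numeratorHom_apply,
    OreLocalization.oreDiv_eq_iff] at h
  obtain ⟨⟨_, k, rfl⟩, v, h₁, h₂⟩ := h
  simp only [OneMemClass.coe_one, mul_one] at h₂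
  subst h₂
  exact ⟨k, h₁.symm⟩

namespace Equipment

variable {G : Type*} [Group G] (O : Equipment G)

/-! ### Rewriting words -/

/-- The generator `x_g`, in the monoid obtained from `S(G, O)` by adjoining a unit. -/
def letter (g : O.Elem) : WithOne O.FactSemigroup := (O.gen g : WithOne O.FactSemigroup)

theorem letter_mul_letter (a b : O.Elem) :
    O.letter a * O.letter b = O.letter b * O.letter (O.conjInv b.1 a) := by
  rw [letter, letter, letter, ← WithOne.coe_mul, ← WithOne.coe_mul, WithOne.coe_inj]
  exact (Con.eq _).2 (ConGen.Rel.of _ _ (Rel.right a b))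

theorem letter_mul_letter_pow (a b : O.Elem) (k : ℕ) :
    O.letter a * O.letter b ^ k = O.letter b ^ k * O.letter (O.conjInv (b.1 ^ k) a) := by
  induction k generalizing a with
  | zero => simp [conjInv]
  | succ k ih =>
    rw [pow_succ', ← mul_assoc, letter_mul_letter, mul_assoc, ih, mul_assoc]
    congr 3
    simp [conjInv, pow_succ', mul_assoc]

theorem exists_prod_letter (m : WithOne O.FactSemigroup) :
    ∃ L : List O.Elem, m = (L.map O.letter).prod := by
  induction m using WithOne.recOneCoe with
  | one => exact ⟨[], rfl⟩
  | coe s =>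
    obtain ⟨w⟩ := s
    induction w using FreeSemigroup.recOnMul with
    | ih1 a => exact ⟨[a], by simp; rfl⟩
    | ih2 a w _ ih =>
      obtain ⟨L, hL⟩ := ih
      exact ⟨a :: L, by rw [List.map_cons, List.prod_cons, ← hL]; rfl⟩

theorem commute_of_commute_letter {t : WithOne O.FactSemigroup}
    (h : ∀ a, Commute t (O.letter a)) (m : WithOne O.FactSemigroup) : Commute t m := by
  obtain ⟨L, rfl⟩ := O.exists_prod_letter m
  refine Commute.list_prod_right _ _ fun x hx => ?_
  obtain ⟨a, -, rfl⟩ := List.mem_map.1 hx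
  exact h a

/-- Moving a letter past `x_g ^ n` conjugates it by `g ^ n = 1`. -/
theorem commute_letter_pow {g : O.Elem} {n : ℕ} (hn : g.1 ^ n = 1)
    (m : WithOne O.FactSemigroup) : Commute (O.letter g ^ n) m := by
  refine O.commute_of_commute_letter (fun a => ?_) m
  rw [Commute, SemiconjBy, letter_mul_letter_pow]
  simp [conjInv, hn]

/-- Equal letters of a word can be collected at its beginning. -/
theorem exists_prod_letter_eq_pow_mul [DecidableEq O.Elem] (g : O.Elem) (k : ℕ)
    (L : List O.Elem) (h : k ≤ L.count g) : ∃ L' : List O.Elem, L'.length + k = L.length ∧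
      (L.map O.letter).prod = O.letter g ^ k * (L'.map O.letter).prod := by
  induction L generalizing k with
  | nil => exact ⟨[], by simp_all, by simp_all⟩
  | cons a L ih =>
    rcases k with _ | k
    · exact ⟨a :: L, by simp, by simp⟩
    by_cases hag : a = g
    · subst hag
      obtain ⟨L', h₁, h₂⟩ := ih k (by simpa using h)
      exact ⟨L', by simp; omega, by simp [h₂, pow_succ', mul_assoc]⟩
    · obtain ⟨L', h₁, h₂⟩ := ih (k + 1) (by rwa [List.count_cons_of_ne hag] at h)
      -- The leading letter is pushed past the collected power, which conjugates it.
      refine ⟨O.conjInv (g.1 ^ (k + 1)) a :: L', by simp; omega, ?_⟩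
      rw [List.map_cons, List.prod_cons, h₂, ← mul_assoc, letter_mul_letter_pow, mul_assoc,
        List.map_cons, List.prod_cons]

/-- Every element is a product of powers `x_g ^ n` and a short word. -/
theorem exists_mul_short [Fintype O.Elem] (n : ℕ) (hn : 0 < n) (m : WithOne O.FactSemigroup) :
    ∃ e ∈ Submonoid.closure (Set.range fun g => O.letter g ^ n),
      ∃ f ∈ (fun L : List O.Elem => (L.map O.letter).prod) ''
        {L | L.length ≤ Fintype.card O.Elem * n}, m = e * f := by
  classical
  obtain ⟨L, rfl⟩ := O.exists_prod_letter m
  induction hl : L.length using Nat.strong_induction_on generalizing L with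
  | _ l ih =>
    by_cases hs : l ≤ Fintype.card O.Elem * n
    · exact ⟨1, one_mem _, _, ⟨L, hl.trans_le hs, rfl⟩, (one_mul _).symm⟩
    -- Pigeonhole: a word longer than `|O| * n` repeats some letter at least `n` times.
    obtain ⟨g, hg⟩ : ∃ g, n ≤ (L : Multiset O.Elem).count g := by
      by_contra! hc
      have h₁ : ∑ g, (L : Multiset O.Elem).count g = L.length :=
        Multiset.sum_count_eq_card fun a _ => Finset.mem_univ a
      have h₂ : ∑ g, (L : Multiset O.Elem).count g ≤ ∑ _g : O.Elem, n := Finset.sum_le_sum fun g _ => (hc g).le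
      simp only [Finset.sum_const, smul_eq_mul, Finset.card_univ] at h₂
      omega
    obtain ⟨L', h₁, h₂⟩ := O.exists_prod_letter_eq_pow_mul g n L (by simpa using hg)
    obtain ⟨e, he, f, hf, h₃⟩ := ih L'.length (by omega) L' rfl
    exact ⟨O.letter g ^ n * e, mul_mem (Submonoid.subset_closure ⟨g, rfl⟩) he, f, hf, by
      rw [h₂, h₃, mul_assoc]⟩

theorem exists_uniform_pow_mul_eq [Finite G] (z : WithOne O.FactSemigroup) :
    ∃ K : ℕ, ∀ (k : ℕ) (a b : WithOne O.FactSemigroup),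
      z ^ k * a = z ^ k * b → z ^ K * a = z ^ K * b := by
  have := Fintype.ofFinite O.Elem
  exact _root_.exists_uniform_pow_mul_eq (fun g => O.letter g ^ Nat.card G)
    (fun g m => O.commute_letter_pow pow_card_eq_one' m) _
    ((List.finite_length_le _ _).image _) (O.exists_mul_short _ Nat.card_pos) z

/-! ### The central element -/

/-- There is a central element with trivial product that is divisible by every generator. -/
theorem exists_central [Finite G] (hne : O.carrier.Nonempty) :
    ∃ z : O.FactSemigroup, O.prodHom z = 1 ∧
      (∀ m : WithOne O.FactSemigroup, Commute (z : WithOne O.FactSemigroup) m) ∧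
      (∀ g, ∃ w, O.letter g * w = z) ∧ ∀ g, ∃ w, w * O.letter g = z := by
  have := Fintype.ofFinite O.Elem
  let L := (Finset.univ : Finset O.Elem).toList
  let p (g : O.Elem) := O.letter g ^ Nat.card G
  let Z := (L.map p).prod
  have hp (g : O.Elem) (m) : Commute (p g) m := O.commute_letter_pow pow_card_eq_one' m
  have hZ (m) : Commute Z m := by
    refine Commute.list_prod_left _ _ fun x hx => ?_
    obtain ⟨g, -, rfl⟩ := List.mem_map.1 hx
    exact hp g m
  obtain ⟨n, hn⟩ := Nat.exists_eq_succ_of_ne_zero (Nat.card_pos (α := G)).ne'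
  have hdvd (g : O.Elem) : ∃ w, p g * w = Z := by
    obtain ⟨A, B, hAB⟩ := List.append_of_mem (Finset.mem_toList.2 (Finset.mem_univ g))
    refine ⟨(A.map p).prod * (B.map p).prod, ?_⟩
    simp only [Z, L, hAB, List.map_append, List.map_cons, List.prod_append, List.prod_cons]
    rw [← mul_assoc, (hp g _).eq, mul_assoc]
  have hleft (g : O.Elem) : ∃ w, O.letter g * w = Z := by
    obtain ⟨w, hw⟩ := hdvd g
    exact ⟨O.letter g ^ n * w, by rw [← hw, ← mul_assoc, ← pow_succ', ← Nat.succ_eq_add_one, ← hn]⟩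
  have hright (g : O.Elem) : ∃ w, w * O.letter g = Z := by
    obtain ⟨w, hw⟩ := hdvd g
    exact ⟨w * O.letter g ^ n, by
      rw [← hw, (hp g w).eq, mul_assoc, ← pow_succ, ← Nat.succ_eq_add_one, ← hn]⟩
  have hprod : WithOne.lift O.prodHom Z = 1 := by
    rw [map_list_prod, List.map_map]
    refine List.prod_eq_one fun x hx => ?_
    obtain ⟨g, -, rfl⟩ := List.mem_map.1 hx
    simp [p]
  -- `Z` is not the adjoined unit: some letter divides it, and no letter divides `1`.
  obtain ⟨z, hz⟩ : ∃ z : O.FactSemigroup, (z : WithOne O.FactSemigroup) = Z := by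
    rw [← WithOne.ne_one_iff_exists]
    intro h
    obtain ⟨g, hg⟩ := hne
    obtain ⟨w, hw⟩ := hleft ⟨g, hg⟩
    rw [h] at hw
    induction w using WithOne.recOneCoe with
    | one => exact WithOne.coe_ne_one ((mul_one _).symm.trans hw)
    | coe w => exact WithOne.coe_ne_one ((WithOne.coe_mul _ _).trans hw)
  rw [← hz] at hZ hprod
  exact ⟨z, by simpa using hprod, hZ, by simpa only [hz] using hleft, by simpa only [hz] using hright⟩

theorem factorSubgroup_gen (g : O.Elem) : O.factorSubgroup (O.gen g) = Subgroup.closure {g.1} :=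
  O.wordSubgroup_of g

/-- An element divisible by every generator has full factor subgroup. -/
theorem factorSubgroup_eq_top (hgen : Subgroup.closure O.carrier = ⊤) {s : O.FactSemigroup}
    (hs : ∀ g, ∃ w, O.letter g * w = s) : O.factorSubgroup s = ⊤ := by
  rw [eq_top_iff, ← hgen, Subgroup.closure_le]
  intro g hg
  obtain ⟨w, hw⟩ := hs ⟨g, hg⟩
  have hmem : g ∈ O.factorSubgroup (O.gen ⟨g, hg⟩) := by
    rw [factorSubgroup_gen]
    exact Subgroup.subset_closure rfl
  induction w using WithOne.recOneCoe with
  | one =>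
    rw [mul_one, letter, WithOne.coe_inj] at hw
    rwa [← hw]
  | coe w =>
    rw [letter, ← WithOne.coe_mul, WithOne.coe_inj] at hw
    rw [← hw, factorSubgroup_mul]
    exact Subgroup.mem_sup_left hmem

/-! ### Comparison with the `C`-group -/

/-- The monoid homomorphism to the `C`-group extending `O.cprodHom`. -/
def cprodMonoidHom : WithOne O.FactSemigroup →* O.CGroup := WithOne.lift O.cprodHom

@[simp] theorem cprodMonoidHom_coe (s : O.FactSemigroup) :
    O.cprodMonoidHom s = O.cprodHom s := WithOne.lift_coe _ _

@[simp] theorem cprodMonoidHom_letter (g : O.Elem) :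
    O.cprodMonoidHom (O.letter g) = O.cgen g := rfl

theorem beta_cgen (g : O.Elem) : O.beta (O.cgen g) = g.1 := PresentedGroup.toGroup.of _

theorem beta_cprodHom (s : O.FactSemigroup) : O.beta (O.cprodHom s) = O.prodHom s := by
  have h : O.beta.comp O.cprodMonoidHom = WithOne.lift O.prodHom := by
    ext m
    obtain ⟨L, rfl⟩ := O.exists_prod_letter m
    simp only [map_list_prod, List.map_map]
    congr 2
    ext g
    exact O.beta_cgen g
  simpa using DFunLike.congr_fun h (s : WithOne O.FactSemigroup)

/-- Elements with equal images in the `C`-group become equal after multiplication by a power of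
a central element divisible by every generator. -/
theorem exists_pow_mul_eq_of_cprod_eq {z : WithOne O.FactSemigroup} (hz : ∀ m, Commute z m)
    (hleft : ∀ g, ∃ w, O.letter g * w = z) (hright : ∀ g, ∃ w, w * O.letter g = z)
    {a b : WithOne O.FactSemigroup} (h : O.cprodMonoidHom a = O.cprodMonoidHom b) :
    ∃ k : ℕ, z ^ k * a = z ^ k * b := by
  let : OreLocalization.OreSet (Submonoid.powers z) :=
    OreLocalization.oreSetOfCentral _ (by rintro _ ⟨k, rfl⟩ m; exact (hz m).pow_left k)
  let ν : WithOne O.FactSemigroup →* OreLocalization (Submonoid.powers z) _ :=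
    OreLocalization.numeratorHom
  have hunit (g : O.Elem) : IsUnit (ν (O.letter g)) := by
    have hνz : IsUnit (ν z) := OreLocalization.numerator_isUnit ⟨z, Submonoid.mem_powers z⟩
    obtain ⟨v, hv⟩ := hleft g
    obtain ⟨w, hw⟩ := hright g
    rw [isUnit_iff_exists_and_exists]
    obtain ⟨u, hu⟩ := hνz
    -- Left divisibility of `z` gives a right inverse, right divisibility a left one.
    refine ⟨⟨ν v * ↑u⁻¹, ?_⟩, ⟨↑u⁻¹ * ν w, ?_⟩⟩
    · rw [← mul_assoc, ← map_mul, hv, ← hu, Units.mul_inv]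
    · rw [mul_assoc, ← map_mul, hw, ← hu, Units.inv_mul]
  choose u hu using hunit
  let ψ : O.CGroup →* (OreLocalization (Submonoid.powers z) (WithOne O.FactSemigroup))ˣ :=
    PresentedGroup.toGroup (f := u) (by
      rintro r ⟨v₁, v₂, v₃, hv, rfl⟩
      have hc : O.conjInv v₃.1 v₁ = v₂ := Subtype.ext hv
      have hrel : u v₁ * u v₃ = u v₃ * u v₂ := by
        ext
        simp only [Units.val_mul, hu, ← map_mul]
        rw [letter_mul_letter, hc]
      simp only [map_mul, map_inv, FreeGroup.lift_apply_of]
      rw [mul_assoc _ (u v₁), hrel]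
      group)
  have hψ (g : O.Elem) : ψ (O.cgen g) = u g := PresentedGroup.toGroup.of _
  have hν (m) : (ψ (O.cprodMonoidHom m) : OreLocalization (Submonoid.powers z) _) = ν m := by
    obtain ⟨L, rfl⟩ := O.exists_prod_letter m
    induction L with
    | nil => simp
    | cons g L ih => simp only [List.map_cons, List.prod_cons, map_mul, Units.val_mul, ih,
        cprodMonoidHom_letter, hψ, hu]
  refine exists_pow_mul_eq_of_numeratorHom_eq z ?_
  change ν a = ν b
  rw [← hν, ← hν, h]

/-- Every element of `G_Γ` is a fraction with a power of `z` as denominator: an inverse letter is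
absorbed by one more factor `z`. -/
theorem exists_mul_pow_eq_cprod {z : WithOne O.FactSemigroup} (hz : ∀ m, Commute z m)
    (hleft : ∀ g, ∃ w, O.letter g * w = z) (γ : O.CGroup) :
    ∃ (k : ℕ) (m : WithOne O.FactSemigroup),
      γ * O.cprodMonoidHom (z ^ k) = O.cprodMonoidHom m := by
  have hγ : γ ∈ Subgroup.closure (Set.range O.cgen) := by
    have := PresentedGroup.closure_range_of O.graphRels
    exact this ▸ Subgroup.mem_top γ
  induction hγ using Subgroup.closure_induction_right with
  | one => exact ⟨0, 1, by simp⟩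
  | mul_right γ _ y hy ih =>
    obtain ⟨g, rfl⟩ := hy
    obtain ⟨k, m, h⟩ := ih
    refine ⟨k, m * O.letter g, ?_⟩
    rw [mul_assoc, ← cprodMonoidHom_letter, ← map_mul, ← ((hz _).pow_left k).eq, map_mul,
      ← mul_assoc, h, map_mul]
  | mul_inv_cancel γ _ y hy ih =>
    obtain ⟨g, rfl⟩ := hy
    obtain ⟨k, m, h⟩ := ih
    obtain ⟨w, hw⟩ := hleft g
    refine ⟨k + 1, m * w, ?_⟩
    have hzk : z ^ (k + 1) = O.letter g * (z ^ k * w) := by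
      rw [← mul_assoc, ← ((hz _).pow_left k).eq, mul_assoc, hw, pow_succ]
    rw [hzk, map_mul, cprodMonoidHom_letter, mul_assoc, inv_mul_cancel_left, map_mul, ← mul_assoc,
      h, map_mul]

/-! ### Stability and the ambiguity index -/

/-- If the ambiguity index is one, then any subsemigroup containing all elements with trivial
product and full factor subgroup is stable. -/
theorem isStable_of_ambiguityIndex_eq_one [Finite G] (hne : O.carrier.Nonempty)
    (hgen : Subgroup.closure O.carrier = ⊤) (T : Subsemigroup O.FactSemigroup)
    (hT : O.withFactorSubgroup ⊤ ⊓ O.withProductIn ⊥ ≤ T) (h : O.ambiguityIndex = 1) :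
    O.IsStable T := by
  obtain ⟨z, hz₁, hz, hleft, hright⟩ := O.exists_central hne
  obtain ⟨K, hK⟩ := O.exists_uniform_pow_mul_eq (z : WithOne O.FactSemigroup)
  -- `K` may be `0`; the exponent `K + 1` keeps the witness inside the semigroup and divisible by
  -- every letter.
  obtain ⟨s, hs⟩ : ∃ s : O.FactSemigroup, (s : WithOne O.FactSemigroup) = z ^ (K + 1) := by
    clear hK
    induction K with
    | zero => exact ⟨z, by simp⟩
    | succ K ih =>
      obtain ⟨s, hs⟩ := ih
      exact ⟨s * z, by rw [WithOne.coe_mul, hs, ← pow_succ]⟩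
  refine ⟨s, hT ⟨O.factorSubgroup_eq_top hgen fun g => ?_, ?_⟩, fun s₁ _ s₂ _ hprod htype => ?_⟩
  · obtain ⟨w, hw⟩ := hleft g
    exact ⟨w * (z : WithOne O.FactSemigroup) ^ K, by rw [← mul_assoc, hw, hs, pow_succ']⟩
  · change O.prodHom s ∈ (⊥ : Subgroup G)
    rw [Subgroup.mem_bot, ← WithOne.lift_coe O.prodHom s, hs, map_pow, WithOne.lift_coe, hz₁,
      one_pow]
  · have hsub : O.beta.ker ⊓ commutator O.CGroup = ⊥ := Subgroup.card_eq_one.1 h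
    have hmem : O.cprodHom s₁ / O.cprodHom s₂ ∈ O.beta.ker ⊓ commutator O.CGroup := by
      refine Subgroup.mem_inf.2 ⟨?_, ?_⟩
      · rw [MonoidHom.mem_ker, map_div, beta_cprodHom, beta_cprodHom, hprod,
          div_self']
      · rw [← Abelianization.ker_of, MonoidHom.mem_ker, map_div, div_eq_one]
        exact htype
    rw [hsub, Subgroup.mem_bot, div_eq_one] at hmem
    obtain ⟨k, hk⟩ := O.exists_pow_mul_eq_of_cprod_eq hz hleft hright
      (a := s₁) (b := s₂) (by simpa using hmem)
    have hKs := hK k _ _ hk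
    rw [← WithOne.coe_inj, WithOne.coe_mul, WithOne.coe_mul, hs,
      ← ((hz _).pow_left _).eq, ← ((hz _).pow_left _).eq, pow_succ', mul_assoc, hKs, mul_assoc]

/-- If some subsemigroup containing all elements with trivial product and full factor subgroup is
stable, then the ambiguity index is one. -/
theorem ambiguityIndex_eq_one_of_isStable [Finite G] (hne : O.carrier.Nonempty)
    (hgen : Subgroup.closure O.carrier = ⊤) (T : Subsemigroup O.FactSemigroup)
    (hT : O.withFactorSubgroup ⊤ ⊓ O.withProductIn ⊥ ≤ T) (h : O.IsStable T) :
    O.ambiguityIndex = 1 := by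
  obtain ⟨z, hz₁, hz, hleft, -⟩ := O.exists_central hne
  obtain ⟨s, -, hs⟩ := h
  -- The extra factor `z` excludes the adjoined unit and forces a full factor subgroup.
  have hcoe (m : WithOne O.FactSemigroup) : ∃ t : O.FactSemigroup,
      (t : WithOne O.FactSemigroup) = z * m := by
    induction m using WithOne.recOneCoe with
    | one => exact ⟨z, (mul_one _).symm⟩
    | coe t => exact ⟨z * t, WithOne.coe_mul _ _⟩
  have hcz : O.beta (O.cprodHom z) = 1 := by rw [beta_cprodHom, hz₁]
  have hmemT {t : O.FactSemigroup} {m : WithOne O.FactSemigroup}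
      (ht : (t : WithOne O.FactSemigroup) = z * m) (hp : O.beta (O.cprodHom t) = 1) : t ∈ T := by
    refine hT ⟨O.factorSubgroup_eq_top hgen fun g => ?_, ?_⟩
    · obtain ⟨w, hw⟩ := hleft g
      exact ⟨w * m, by rw [← mul_assoc, hw, ht]⟩
    · change O.prodHom t ∈ (⊥ : Subgroup G)
      rwa [Subgroup.mem_bot, ← beta_cprodHom]
  rw [ambiguityIndex, Subgroup.card_eq_one, eq_bot_iff]
  intro γ hγ
  obtain ⟨hγ₁, hγ₂⟩ := Subgroup.mem_inf.1 hγ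
  rw [MonoidHom.mem_ker] at hγ₁
  rw [← Abelianization.ker_of, MonoidHom.mem_ker] at hγ₂
  obtain ⟨k, m, hm⟩ := O.exists_mul_pow_eq_cprod hz hleft γ
  -- With `s₁ = z * m` and `s₂ = z ^ (k + 1)`, the images in `G_Γ` differ exactly by `γ`.
  obtain ⟨s₁, hs₁⟩ := hcoe m
  obtain ⟨s₂, hs₂⟩ := hcoe ((z : WithOne O.FactSemigroup) ^ k)
  have hc₂ : O.cprodHom s₂ = O.cprodHom z * O.cprodHom z ^ k := by
    rw [← cprodMonoidHom_coe, hs₂, map_mul, map_pow, cprodMonoidHom_coe]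
  have hc : O.cprodHom s₁ = γ * O.cprodHom s₂ := by
    rw [← cprodMonoidHom_coe, ← cprodMonoidHom_coe, hs₁, hs₂, (hz m).eq, map_mul, ← hm,
      (hz _).eq, map_mul, mul_assoc]
  have hb₂ : O.beta (O.cprodHom s₂) = 1 := by simp [hc₂, hcz]
  have hb₁ : O.beta (O.cprodHom s₁) = 1 := by rw [hc, map_mul, hγ₁, hb₂, one_mul]
  have heq := hs s₁ (hmemT hs₁ hb₁) s₂ (hmemT hs₂ hb₂)
    (by rw [← beta_cprodHom, ← beta_cprodHom, hb₁, hb₂])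
    (by
      change Abelianization.of (O.cprodHom s₁) = Abelianization.of (O.cprodHom s₂)
      rw [hc, map_mul, hγ₂, one_mul])
  have := congrArg O.cprodHom heq
  rw [map_mul, map_mul, mul_left_inj, hc, mul_eq_right] at this
  exact this

/-- All four semigroups contain the smallest one, `S(G, O)^G_1`, where both directions find the
elements they need. -/
theorem isStable_iff_ambiguityIndex_eq_one [Finite G] (hne : O.carrier.Nonempty)
    (hgen : Subgroup.closure O.carrier = ⊤) (T : Subsemigroup O.FactSemigroup)
    (hT : O.withFactorSubgroup ⊤ ⊓ O.withProductIn ⊥ ≤ T) :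
    O.IsStable T ↔ O.ambiguityIndex = 1 :=
  ⟨O.ambiguityIndex_eq_one_of_isStable hne hgen T hT,
    O.isStable_of_ambiguityIndex_eq_one hne hgen T hT⟩

end Equipment

theorem mainTheorem6 {G : Type*} [Group G] [Finite G] (O : Equipment G)
    (hne : O.carrier.Nonempty) (hgen : Subgroup.closure O.carrier = ⊤) :
    (O.IsStable ⊤ ↔ O.ambiguityIndex = 1) ∧
    (O.IsStable (O.withFactorSubgroup ⊤) ↔ O.ambiguityIndex = 1) ∧
    (O.IsStable (O.withProductIn ⊥) ↔ O.ambiguityIndex = 1) ∧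
    (O.IsStable (O.withFactorSubgroup ⊤ ⊓ O.withProductIn ⊥) ↔ O.ambiguityIndex = 1) :=
  ⟨O.isStable_iff_ambiguityIndex_eq_one hne hgen _ le_top,
    O.isStable_iff_ambiguityIndex_eq_one hne hgen _ inf_le_left,
    O.isStable_iff_ambiguityIndex_eq_one hne hgen _ inf_le_right,
    O.isStable_iff_ambiguityIndex_eq_one hne hgen _ le_rfl⟩
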